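/- Let $K$ be a field with $2\ne 0$ in $K$, let $n,m\in\mathbb N$ with $n\ge 3$ (or $n=2$, $m=1$). Let $Q_{\mathrm{univ}}(n)$ be the quiver with vertices $1,\dots,n$ and exactly one arrow from $a$ to $b$ for every ordered pair $a\neq b$. Consider its representation with $K^{2m}$ at every vertex and the identity matrix at every arrow. Order the union of the standard bases as $B=\{1,\dots,2mn\}$, where $B_a=\{2m(a-1)+1,\dots,2ma\}$ belongs to the vertex $a$, and let $I\subset B$ consist of the last $m$ elements of every $B_a$. For $J\subseteq B$ let $\Delta_J$ be a variable, and put $\Delta_s^{s'}=\Delta_{(I\setminus\{s\})\cup\{s'\}}$. The quiver relations are, for every arrow $v:a\to b$ with matrix $M_v$ and all $s\in I\cap B_a$, $t\in B_b\setminus I$, $$\sum_{s',t'}(-1)^{\epsilon(s')}M_{v,s',t'}\,\Delta_s^{s'}\Delta_{t'}^{t}-\sum_{s'}(-1)^{\epsilon(s')}M_{v,s',t}\,\Delta_s^{s'}\Delta_I=0,$$ where $s'$ runs over $B_a\setminus(I\setminus\{s\})$, $t'$ over $B_b\cap I$, the entries of $M_v$ are indexed by the positions of $s',t',t$ in their blocks,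 and $\epsilon(s')$ is the number of elements of $I$ strictly between $s$ and $s'$. Let $A$ be the quotient of $K[\Delta_J: J\subseteq B]$ by these relations together with $\Delta_I=1$ and $\Delta_J=0$ for every $J$ with $|J\cap B_a|\ne m$ for some $a$; thus the $\Delta_J\in A$ are the coordinates of the general solution. Let $\mathrm{Fset}$ be the set of all $J$ such that $\Delta_J$ is one of the symbols $\Delta_s^{s'},\Delta_{t'}^{t}$ of some quiver relation and $\Delta_J\neq0$ in $A$. If $c_1<c_2<\dots$ are the elements of $B\setminus J$, let $\lambda(J)$ be the Young diagram with row lengths $c_r-r+1$. Let $s_\lambda$ be the Schur function, as a polynomial in the complete symmetric functions $h_1,h_2,\dots$ (Jacobi–Trudi), and put $$\tilde P_{\max}(Q_{\mathrm{univ}}(n),2m,\mathrm{Id})=\sum_{J\in\mathrm{Fset},\,J\ne I}\Delta_J\,s_{\lambda(J)}.$$ Let $L_m=\{(p,u): 1\le p,u\le m,\ p\text{ odd}\}$ be the set of admissible cells of the $m\times m$ ladder. For $i=(p,u)\in L_m$ and $1\le j\le n$ let $\lambda(i,j)$ be the Young diagram obtained from the base diagram, which has $n$ groups of $m$ rows,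 the rows of group $a$ having length $(a-1)m+1$, by adding the ladder block $(0^{m-u},1^{u-1},p)$ (written in weakly increasing order) to the rows of group $j$. Then: 1. $|L_m|=m\lceil m/2\rceil$, and the diagrams $\lambda(i,j)$ with $i\in L_m$, $1\le j\le n$ are pairwise distinct. 2. $J\mapsto\lambda(J)$ is a bijection from $\mathrm{Fset}\setminus\{I\}$ onto $\{\lambda(i,j): i\in L_m,\ 1\le j\le n\}$. 3. For fixed $i$ the coordinates $\Delta_J$ with $J\in\mathrm{Fset}$ and $\lambda(J)=\lambda(i,j)$, $1\le j\le n$, have one common value $\Delta_{\lambda(i,*)}\in A$; the elements $\Delta_{\lambda(i,*)}$, $i\in L_m$, are algebraically independent over $K$; and $$\tilde P_{\max}(Q_{\mathrm{univ}}(n),2m,\mathrm{Id})=\sum_{i\in L_m}\ \sum_{j=1}^{n}s_{\lambda(i,j)}\,\Delta_{\lambda(i,*)},$$ so there are $m\lceil m/2\rceil$ $\Delta$-summands with $n$ Schur functions each. -/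

import Mathlib

open scoped BigOperators

namespace QuiverPlucker

noncomputable section

/-! ### Young diagrams and Schur functions -/

/-- The ring of symmetric functions with coefficients in `A`: the polynomial ring in the complete
homogeneous symmetric functions; the variable `X k` is `h_(k+1)`. -/
abbrev Symm (A : Type*) [CommRing A] : Type _ := MvPolynomial ℕ A

/-- The complete homogeneous symmetric functions, with `h_0 = 1` and `h_k = 0` for `k < 0`. -/
def h (A : Type*) [CommRing A] : ℤ → Symm A
  | Int.ofNat 0 => 1
  | Int.ofNat (k + 1) => MvPolynomial.X k
  | Int.negSucc _ => 0

/-- The Schur function of a Young diagram, by the Jacobi-Trudi determinant. -/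
def schur (A : Type*) [CommRing A] (μ : YoungDiagram) : Symm A :=
  Matrix.det (Matrix.of fun i j : Fin (μ.colLen 0) =>
    h A ((μ.rowLen i : ℤ) - (i : ℤ) + (j : ℤ)))

/-- The Young diagram whose multiset of row lengths is `s`. -/
def diagramOfParts (s : Multiset ℕ) : YoungDiagram :=
  YoungDiagram.ofRowLens (s.sort (· ≥ ·)) (Multiset.pairwise_sort s (· ≥ ·)).sortedGE

/-! ### Coordinates and quiver relations

A representation with a `d`-dimensional space at every vertex has the ordered basis `V ×ₗ Fin d`:
the `d` basis vectors of the first vertex, then those of the second vertex, and so on. -/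

section Relations

variable {V : Type*} [Fintype V] [LinearOrder V] {d : ℕ}

/-- The basis vectors at the vertex `a`. -/
def block (d : ℕ) (a : V) : Finset (V ×ₗ Fin d) :=
  Finset.univ.filter fun x => (ofLex x).1 = a

/-- The reference index set `I`: the last `e` basis vectors of every vertex. -/
def refSet (V : Type*) [Fintype V] (d e : ℕ) : Finset (V ×ₗ Fin d) :=
  Finset.univ.filter fun x => d ≤ ((ofLex x).2 : ℕ) + e

/-- `(I \ {s}) ∪ {s'}`, the index set of the coordinate `Δ_s^{s'}`. -/
def exchange (I : Finset (V ×ₗ Fin d)) (s s' : V ×ₗ Fin d) : Finset (V ×ₗ Fin d) :=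
  insert s' (I.erase s)

/-- The number of elements of `I` strictly between `s` and `s'`. -/
def eps (I : Finset (V ×ₗ Fin d)) (s s' : V ×ₗ Fin d) : ℕ :=
  (I.filter fun i => min s s' < i ∧ i < max s s').card

/-- The Young diagram of the coordinate `Δ_J`: if `c_1 < c_2 < ...` are the elements of the
complement of `J` (as positions `1, 2, ...`), its rows have lengths `c_r - r + 1`, that is, each
`c` outside `J` gives a row with one box more than there are elements of `J` below `c`. -/
def young (J : Finset (V ×ₗ Fin d)) : YoungDiagram :=
  diagramOfParts
    ((Finset.univ \ J).val.map fun c => (J.filter fun i => i < c).card + 1)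

variable (K : Type*) [Field K]

/-- The indices `s'` for which `Δ_s^{s'}` occurs, where `s` is in the block of `a`. -/
def srcRange (e : ℕ) (a : V) (s : V ×ₗ Fin d) : Finset (V ×ₗ Fin d) :=
  block d a \ (refSet V d e).erase s

/-- The indices `t'` for which `Δ_{t'}^t` occurs, where `t` is in the block of `b`. -/
def tgtRange (d e : ℕ) (b : V) : Finset (V ×ₗ Fin d) :=
  block d b ∩ refSet V d e

/-- The left hand side of the quiver relation `F(v, s, t)`, for an arrow `v` from `a` to `b` whose
matrix is `M`, in the polynomial ring in the symbols `Δ_J`. -/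
def quiverRel (e : ℕ) {K : Type*} [Field K] (a b : V) (M : Matrix (Fin d) (Fin d) K)
    (s t : V ×ₗ Fin d) : MvPolynomial (Finset (V ×ₗ Fin d)) K :=
  (∑ s' ∈ srcRange e a s, ∑ t' ∈ tgtRange d e b,
    MvPolynomial.C ((-1) ^ eps (refSet V d e) s s' * M (ofLex s').2 (ofLex t').2) *
      MvPolynomial.X (exchange (refSet V d e) s s') *
      MvPolynomial.X (exchange (refSet V d e) t' t)) -
  ∑ s' ∈ srcRange e a s,
    MvPolynomial.C ((-1) ^ eps (refSet V d e) s s' * M (ofLex s').2 (ofLex t).2) *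
      MvPolynomial.X (exchange (refSet V d e) s s') *
      MvPolynomial.X (refSet V d e)

/-- A proper index set: it has exactly `e` elements in every block. -/
def IsProper (e : ℕ) (J : Finset (V ×ₗ Fin d)) : Prop :=
  ∀ a : V, (J ∩ block d a).card = e

variable {K}
variable (Q : Quiver V) (e : ℕ) (M : ∀ a b : V, Q.Hom a b → Matrix (Fin d) (Fin d) K)

/-- All equations that are solved: the quiver relations of all arrows, the vanishing of the
coordinates with a non-proper index set, and the normalization `Δ_I = 1`. -/
inductive IsRelation : MvPolynomial (Finset (V ×ₗ Fin d)) K → Prop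
  | quiver (a b : V) (v : Q.Hom a b) (s t : V ×ₗ Fin d)
      (hs : s ∈ block d a ∩ refSet V d e) (ht : t ∈ block d b \ refSet V d e) :
      IsRelation (quiverRel e a b (M a b v) s t)
  | nonproper (J : Finset (V ×ₗ Fin d)) (hJ : ¬ IsProper e J) : IsRelation (MvPolynomial.X J)
  | normalization : IsRelation (MvPolynomial.X (refSet V d e) - 1)

/-- The ring of functions on the set of all solutions, i.e. the ring in which the general solution
of the quiver relations has its coordinates. -/
abbrev SolRing : Type _ :=
  MvPolynomial (Finset (V ×ₗ Fin d)) K ⧸ Ideal.span {f | IsRelation Q e M f}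

/-- The value of the coordinate `Δ_J` in the general solution. -/
def coord (J : Finset (V ×ₗ Fin d)) : SolRing Q e M :=
  Ideal.Quotient.mk (Ideal.span {f | IsRelation Q e M f}) (MvPolynomial.X J)

/-- `Δ_J` is one of the symbols `Δ_s^{s'}`, `Δ_{t'}^t` of some quiver relation. -/
inductive Occurs : Finset (V ×ₗ Fin d) → Prop
  | src (a b : V) (v : Q.Hom a b) (s t s' : V ×ₗ Fin d)
      (hs : s ∈ block d a ∩ refSet V d e) (ht : t ∈ block d b \ refSet V d e)
      (hs' : s' ∈ srcRange e a s) : Occurs (exchange (refSet V d e) s s')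
  | tgt (a b : V) (v : Q.Hom a b) (s t t' : V ×ₗ Fin d)
      (hs : s ∈ block d a ∩ refSet V d e) (ht : t ∈ block d b \ refSet V d e)
      (ht' : t' ∈ tgtRange d e b) : Occurs (exchange (refSet V d e) t' t)

open Classical in
/-- The set of the coordinates that occur in the quiver relations and do not vanish identically. -/
def fset : Finset (Finset (V ×ₗ Fin d)) :=
  Finset.univ.filter fun J => Occurs Q e J ∧ coord Q e M J ≠ 0

/-- The polynomial of the general solution: the sum of `Δ_J s_{λ(J)}` over the nonvanishing
coordinates `Δ_J` other than the normalized one. -/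
def pMax : Symm (SolRing Q e M) :=
  ∑ J ∈ (fset Q e M).erase (refSet V d e),
    MvPolynomial.C (coord Q e M J) * schur (SolRing Q e M) (young J)

end Relations

/-! ### The universal quiver with identity maps -/

/-- The quiver with `n` vertices and exactly one arrow from each vertex to each other vertex. -/
@[reducible] def univQuiver (n : ℕ) : Quiver (Fin n) := ⟨fun a b => PLift (a ≠ b)⟩

/-- All arrows of the universal quiver act by the `d × d` identity matrix. -/
def idRep (K : Type*) [Field K] (n d : ℕ) :
    ∀ a b : Fin n, (univQuiver n).Hom a b → Matrix (Fin d) (Fin d) K :=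
  fun _ _ _ => 1

/-! ### Ladders -/

/-- The admissible cells `(p, u)` of the `m × m` ladder: those with `p` odd. -/
def ladder (m : ℕ) : Finset (ℕ × ℕ) :=
  (Finset.Icc 1 m ×ˢ Finset.Icc 1 m).filter fun i => Odd i.1

/-- The ladder block of the cell `(p, u)`, as `m` numbers in weakly increasing order:
`u` nonzero entries `1, ..., 1, p` preceded by `m - u` zeros. -/
def ladderBlock (m : ℕ) (i : ℕ × ℕ) (r : Fin m) : ℕ :=
  if (r : ℕ) + 1 = m then i.1 else if m ≤ (r : ℕ) + i.2 then 1 else 0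

/-- The diagram `λ(i, j)`. The base diagram has `n` groups of `m` rows, those of the group `a`
(`a = 0, ..., n - 1`) having length `a * m + 1`; the ladder block `i` is added to the group `j`. -/
def ladderDiagram (n m : ℕ) (i : ℕ × ℕ) (j : Fin n) : YoungDiagram :=
  diagramOfParts ((Finset.univ : Finset (Fin n × Fin m)).val.map fun x =>
    (x.1 : ℕ) * m + 1 + if x.1 = j then ladderBlock m i x.2 else 0)

end

end QuiverPlucker

open QuiverPlucker

namespace QuiverPlucker

/-! ### Diagrams and their row lengths -/

/-! Apart from `I` itself, the only symbols in a quiver relation are single exchanges at one vertex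
`a`: the `i`-th element of the reference set is traded for the `t`-th element outside it (`swapSet a
i t`, both counted from 0). With identity matrices every sum in a relation collapses to one term,
because an entry of the identity survives only when the two positions agree. With `Δ_I = 1`, an
arrow from `a` to `b` just says that the exchange coordinate at `b` is `(-1)^i` times the one at `a`
(`quiverRel_one`, `swapCoord_eq`).

For even `i` the coordinate is therefore the same at all vertices. For odd `i` each arrow changes
the sign; with three vertices, going from `a` to `c` directly or through `b` gives opposite signs,
so twice the coordinate is zero (`swapCoord_of_odd`). If `n = 2` and `m = 1`, only `i = 0` exists.

Nothing else is forced: giving the exchanges with even `i` independent values, the same at all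
vertices, and every other coordinate except `Δ_I` the value zero respects all relations. The
resulting map to a polynomial ring (`genericEval`) shows both that the even coordinates do not
vanish and that they are algebraically independent.

On the combinatorial side, counting the elements of the index set below each missing basis vector
shows that the exchange has the diagram of the cell `(p, u) = (i + 1, m - t)` (`young_swapSet`), so
`p` odd corresponds to `i` even. Finally, a ladder diagram determines its group and its cell
(`ladderDiagram_injOn`). -/

theorem coe_rowLens_diagramOfParts {s : Multiset ℕ} (hs : ∀ x ∈ s, 0 < x) :
    ((diagramOfParts s).rowLens : Multiset ℕ) = s := by
  rw [diagramOfParts, YoungDiagram.rowLens_ofRowLens_eq_self, Multiset.sort_eq]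
  intro x hx
  exact hs x ((Multiset.mem_sort _).1 hx)

/-- Positivity matters because zero parts leave no trace in a diagram. -/
theorem diagramOfParts_injective {s t : Multiset ℕ} (hs : ∀ x ∈ s, 0 < x) (ht : ∀ x ∈ t, 0 < x)
    (h : diagramOfParts s = diagramOfParts t) : s = t := by
  rw [← coe_rowLens_diagramOfParts hs, h, coe_rowLens_diagramOfParts ht]

/-- The length of the row `x` of the diagram `λ(i, j)`. -/
def ladderRow (n m : ℕ) (i : ℕ × ℕ) (j : Fin n) (x : Fin n × Fin m) : ℕ :=
  (x.1 : ℕ) * m + 1 + if x.1 = j then ladderBlock m i x.2 else 0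

/-- The length of the row `x` of the base diagram. -/
def baseRow (n m : ℕ) (x : Fin n × Fin m) : ℕ := (x.1 : ℕ) * m + 1

theorem mem_ladder {m : ℕ} {i : ℕ × ℕ} :
    i ∈ ladder m ↔ ((1 ≤ i.1 ∧ i.1 ≤ m) ∧ 1 ≤ i.2 ∧ i.2 ≤ m) ∧ Odd i.1 := by
  simp [ladder]

theorem map_eq_of_diagram_eq {α : Type*} [Fintype α] {f g : α → ℕ} (hf : ∀ x, 0 < f x)
    (hg : ∀ x, 0 < g x)
    (h : diagramOfParts (Finset.univ.val.map f) = diagramOfParts (Finset.univ.val.map g)) :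
    Finset.univ.val.map f = Finset.univ.val.map g :=
  diagramOfParts_injective (by simpa using hf) (by simpa using hg) h

theorem card_filter_le_eq {α : Type*} [Fintype α] {f g : α → ℕ}
    (h : (Finset.univ : Finset α).val.map f = Finset.univ.val.map g) (k : ℕ) :
    (Finset.univ.filter fun x => f x ≤ k).card = (Finset.univ.filter fun x => g x ≤ k).card := by
  have := congrArg (fun s : Multiset ℕ => (s.filter (· ≤ k)).card) h
  simpa [Multiset.filter_map, Finset.card, Function.comp_def] using this

theorem sum_eq_of_map_eq {α : Type*} [Fintype α] {f g : α → ℕ}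
    (h : (Finset.univ : Finset α).val.map f = Finset.univ.val.map g) :
    ∑ x, f x = ∑ x, g x := congrArg Multiset.sum h

theorem baseRow_le_iff {n m : ℕ} (a : Fin n) (x : Fin n × Fin m) :
    baseRow n m x ≤ a * m + 1 ↔ x.1 ≤ a := by
  have hm : 0 < m := x.2.pos
  rw [baseRow, Nat.add_le_add_iff_right, Nat.mul_le_mul_right_iff hm, Fin.le_def]

theorem ladderBlock_le {m : ℕ} {i : ℕ × ℕ} (hi : i ∈ ladder m) (r : Fin m) :
    ladderBlock m i r ≤ m := by
  rw [mem_ladder] at hi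
  unfold ladderBlock
  split_ifs <;> omega

theorem ladderBlock_eq_zero_iff {m : ℕ} {i : ℕ × ℕ} (hi : i ∈ ladder m) (r : Fin m) :
    ladderBlock m i r = 0 ↔ (r : ℕ) + i.2 < m := by
  rw [mem_ladder] at hi
  unfold ladderBlock
  split_ifs <;> first | omega | (simp; omega)

/-- Block entries are at most `m`, the step between consecutive groups, so lengthened rows of an
earlier group never pass the base length of a later one. Thresholds at the base lengths thus see one
group at a time. -/
theorem ladderRow_le_iff {n m : ℕ} {i : ℕ × ℕ} (hi : i ∈ ladder m) (j a : Fin n)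
    (x : Fin n × Fin m) :
    ladderRow n m i j x ≤ a * m + 1 ↔ x.1 < a ∨ x.1 = a ∧ (a = j → (x.2 : ℕ) + i.2 < m) := by
  have hm : 0 < m := x.2.pos
  have hb := ladderBlock_le hi x.2
  have h0 := ladderBlock_eq_zero_iff hi x.2
  unfold ladderRow
  rcases lt_trichotomy x.1 a with h | h | h
  · have : ((x.1 : ℕ) + 1) * m ≤ a * m := Nat.mul_le_mul_right _ h
    simp only [h, true_or, iff_true]
    split_ifs <;> linarith
  · subst h
    by_cases hj : x.1 = j
    · simp only [hj, if_true, ← h0]; simp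
    · simp [hj]
  · have : ((a : ℕ) + 1) * m ≤ x.1 * m := Nat.mul_le_mul_right _ h
    simp only [h.not_gt, h.ne', false_and, or_false, iff_false, not_le]
    split_ifs <;> nlinarith

theorem ladderRow_pos {n m : ℕ} (i : ℕ × ℕ) (j : Fin n) (x : Fin n × Fin m) :
    0 < ladderRow n m i j x := by unfold ladderRow; omega

theorem baseRow_pos {n m : ℕ} (x : Fin n × Fin m) : 0 < baseRow n m x := by
  unfold baseRow; omega

/-- The rows of length at most `a * m + 1` are those of the groups up to `a` unless the ladder block
sits in the group `a`, where at least the last row is longer. -/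
theorem card_ladderRow_le {n m : ℕ} {i : ℕ × ℕ} (hi : i ∈ ladder m) (j : Fin n) :
    (Finset.univ.filter fun x => ladderRow n m i j x ≤ j * m + 1).card <
      (Finset.univ.filter fun x : Fin n × Fin m => x.1 ≤ j).card := by
  have hi' := mem_ladder.1 hi
  apply Finset.card_lt_card
  rw [Finset.ssubset_iff_of_subset]
  · refine ⟨(j, ⟨m - 1, by omega⟩), by simp, ?_⟩
    simp only [Finset.mem_filter, Finset.mem_univ, true_and, ladderRow_le_iff hi]
    simp
    omega
  · intro x
    simp only [Finset.mem_filter, Finset.mem_univ, true_and, ladderRow_le_iff hi]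
    rintro (h | h)
    exacts [h.le, h.1.le]

theorem card_ladderRow_le_of_ne {n m : ℕ} {i : ℕ × ℕ} (hi : i ∈ ladder m) {j a : Fin n}
    (h : a ≠ j) :
    (Finset.univ.filter fun x => ladderRow n m i j x ≤ a * m + 1).card =
      (Finset.univ.filter fun x : Fin n × Fin m => x.1 ≤ a).card := by
  simp [ladderRow_le_iff hi, h, le_iff_lt_or_eq]

theorem card_ladderRow_lt {n m : ℕ} {i i' : ℕ × ℕ} (hi : i ∈ ladder m) (hi' : i' ∈ ladder m)
    (j : Fin n) (h : i.2 < i'.2) :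
    (Finset.univ.filter fun x => ladderRow n m i' j x ≤ j * m + 1).card <
      (Finset.univ.filter fun x => ladderRow n m i j x ≤ j * m + 1).card := by
  have h1 := mem_ladder.1 hi
  have h2 := mem_ladder.1 hi'
  apply Finset.card_lt_card
  rw [Finset.ssubset_iff_of_subset]
  -- The first row in which the block `i'` is nonzero; the block `i`, having fewer nonzero entries,
  -- still vanishes there.
  · refine ⟨(j, ⟨m - i'.2, by omega⟩), ?_, ?_⟩ <;>
    · simp only [Finset.mem_filter, Finset.mem_univ, true_and, ladderRow_le_iff hi,
        ladderRow_le_iff hi']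
      simp
      omega
  · intro x
    simp only [Finset.mem_filter, Finset.mem_univ, true_and, ladderRow_le_iff hi,
      ladderRow_le_iff hi']
    rintro (h | h)
    · exact Or.inl h
    · exact Or.inr ⟨h.1, fun e => by have := h.2 e; omega⟩

theorem sum_ladderRow_lt {n m : ℕ} {i i' : ℕ × ℕ} (hi : i ∈ ladder m) (j : Fin n)
    (h : i.1 < i'.1) (h' : i.2 = i'.2) :
    ∑ x, ladderRow n m i j x < ∑ x, ladderRow n m i' j x := by
  have h1 := mem_ladder.1 hi
  apply Finset.sum_lt_sum
  · intro x _
    unfold ladderRow ladderBlock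
    rw [h']
    split_ifs <;> omega
  · refine ⟨(j, ⟨m - 1, by omega⟩), Finset.mem_univ _, ?_⟩
    have : m - 1 + 1 = m := by omega
    simp [ladderRow, ladderBlock, this, h]

/-- The count of rows up to the base length of a group falls short only at `j`, which recovers `j`.
The size of the shortfall recovers `u`, and then the total number of boxes recovers `p`. -/
theorem ladderDiagram_injOn (n m : ℕ) :
    Set.InjOn (fun ij : (ℕ × ℕ) × Fin n => ladderDiagram n m ij.1 ij.2)
      {ij | ij.1 ∈ ladder m} := by
  rintro ⟨i, j⟩ hi ⟨i', j'⟩ hi' h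
  have e := map_eq_of_diagram_eq (ladderRow_pos i j) (ladderRow_pos i' j') h
  have hj : j = j' := by
    by_contra hne
    have h1 := card_filter_le_eq e (j * m + 1)
    rw [card_ladderRow_le_of_ne hi' hne] at h1
    exact (card_ladderRow_le hi j).ne h1
  subst hj
  have hu : i.2 = i'.2 := by
    have h1 := card_filter_le_eq e (j * m + 1)
    rcases lt_trichotomy i.2 i'.2 with h2 | h2 | h2
    · exact absurd h1 (card_ladderRow_lt hi hi' j h2).ne'
    · exact h2
    · exact absurd h1 (card_ladderRow_lt hi' hi j h2).ne
  have hp : i.1 = i'.1 := by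
    have h1 := sum_eq_of_map_eq e
    rcases lt_trichotomy i.1 i'.1 with h2 | h2 | h2
    · exact absurd h1 (sum_ladderRow_lt hi j h2 hu).ne
    · exact h2
    · exact absurd h1 (sum_ladderRow_lt hi' j h2 hu.symm).ne'
  rw [Prod.ext hp hu]

theorem ladderDiagram_ne_base {n m : ℕ} {i : ℕ × ℕ} (hi : i ∈ ladder m) (j : Fin n) :
    ladderDiagram n m i j ≠ diagramOfParts (Finset.univ.val.map (baseRow n m)) := by
  intro h
  have h1 := card_filter_le_eq (map_eq_of_diagram_eq (ladderRow_pos i j) baseRow_pos h) (j * m + 1)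
  simp only [baseRow_le_iff] at h1
  exact (card_ladderRow_le hi j).ne h1

/-! ### The number of admissible cells -/

theorem card_odd_Icc (m : ℕ) : ((Finset.Icc 1 m).filter Odd).card = (m + 1) / 2 := by
  induction m with
  | zero => rfl
  | succ k ih =>
    rw [← Finset.insert_Icc_right_eq_Icc_add_one (by omega), Finset.filter_insert]
    split_ifs with h
    · rw [Finset.card_insert_of_notMem (by simp), ih]
      obtain ⟨c, hc⟩ := h
      omega
    · rw [ih]
      rw [Nat.not_odd_iff_even] at h
      obtain ⟨c, hc⟩ := h
      omega

theorem card_ladder (m : ℕ) : (ladder m).card = m * ⌈(m : ℚ) / 2⌉₊ := by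
  have h1 : ladder m = (Finset.Icc 1 m).filter Odd ×ˢ Finset.Icc 1 m := by
    ext ⟨p, u⟩
    simp [ladder]
    tauto
  have h2 : ⌈(m : ℚ) / 2⌉₊ = (m + 1) / 2 := by
    rcases Nat.even_or_odd' m with ⟨c, rfl | rfl⟩
    · rw [show ((2 * c : ℕ) : ℚ) / 2 = c by push_cast; ring, Nat.ceil_natCast]; omega
    · rw [show (2 * c + 1 + 1) / 2 = c + 1 by omega, Nat.ceil_eq_iff (by omega)]
      push_cast
      constructor <;> linarith
  rw [h1, Finset.card_product, card_odd_Icc, h2, Nat.card_Icc, Nat.add_sub_cancel, mul_comm]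


/-! ### Exchange sets -/

section Exchange

variable {n m : ℕ}

/-- The `i`-th basis vector of the reference set at the vertex `a`. -/
def upper (a : Fin n) (i : Fin m) : Fin n ×ₗ Fin (2 * m) := toLex (a, ⟨m + i, by omega⟩)

/-- The `t`-th basis vector outside the reference set at the vertex `a`. -/
def lower (a : Fin n) (t : Fin m) : Fin n ×ₗ Fin (2 * m) := toLex (a, ⟨t, by omega⟩)

/-- The index set obtained from the reference set by an exchange at the vertex `a`. -/
def swapSet (a : Fin n) (i t : Fin m) : Finset (Fin n ×ₗ Fin (2 * m)) :=
  exchange (refSet (Fin n) (2 * m) m) (upper a i) (lower a t)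

theorem mem_refSet {x : Fin n ×ₗ Fin (2 * m)} :
    x ∈ refSet (Fin n) (2 * m) m ↔ m ≤ ((ofLex x).2 : ℕ) := by
  simp only [refSet, Finset.mem_filter, Finset.mem_univ, true_and]
  omega

theorem upper_mem_refSet (a : Fin n) (i : Fin m) : upper a i ∈ refSet (Fin n) (2 * m) m := by
  simp [mem_refSet, upper]

theorem lower_notMem_refSet (a : Fin n) (t : Fin m) : lower a t ∉ refSet (Fin n) (2 * m) m := by
  simp [mem_refSet, lower]

theorem exists_upper {x : Fin n ×ₗ Fin (2 * m)} (hx : x ∈ refSet (Fin n) (2 * m) m) :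
    ∃ i, x = upper (ofLex x).1 i := by
  rw [mem_refSet] at hx
  have := (ofLex x).2.isLt
  refine ⟨⟨(ofLex x).2 - m, by omega⟩, ?_⟩
  apply ofLex.injective
  ext <;> simp [upper]
  omega

theorem exists_lower {x : Fin n ×ₗ Fin (2 * m)} (hx : x ∉ refSet (Fin n) (2 * m) m) :
    ∃ t, x = lower (ofLex x).1 t := by
  rw [mem_refSet] at hx
  refine ⟨⟨(ofLex x).2, by omega⟩, ?_⟩
  apply ofLex.injective
  ext <;> simp [lower]

theorem upper_inj {a b : Fin n} {i j : Fin m} : upper a i = upper b j ↔ a = b ∧ i = j := by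
  simp [upper, Fin.ext_iff]

theorem lower_inj {a b : Fin n} {i j : Fin m} : lower a i = lower b j ↔ a = b ∧ i = j := by
  simp [lower, Fin.ext_iff]

theorem upper_mem_block {a b : Fin n} {i : Fin m} : upper a i ∈ block (2 * m) b ↔ a = b := by
  simp [block, upper]

theorem lower_mem_block {a b : Fin n} {t : Fin m} : lower a t ∈ block (2 * m) b ↔ a = b := by
  simp [block, lower]

theorem lower_ne_upper (a b : Fin n) (i t : Fin m) : lower a t ≠ upper b i := fun h =>
  lower_notMem_refSet a t (h ▸ upper_mem_refSet b i)

theorem exchange_self {I : Finset (Fin n ×ₗ Fin (2 * m))} {s : Fin n ×ₗ Fin (2 * m)}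
    (hs : s ∈ I) : exchange I s s = I := Finset.insert_erase hs

theorem mem_swapSet {a : Fin n} {i t : Fin m} {x : Fin n ×ₗ Fin (2 * m)} :
    x ∈ swapSet a i t ↔ x = lower a t ∨ x ≠ upper a i ∧ x ∈ refSet (Fin n) (2 * m) m := by
  simp [swapSet, exchange]

theorem swapSet_ne_refSet (a : Fin n) (i t : Fin m) :
    swapSet a i t ≠ refSet (Fin n) (2 * m) m := fun h =>
  lower_notMem_refSet a t (h ▸ mem_swapSet.2 (Or.inl rfl))

theorem swapSet_injective :
    Function.Injective fun x : Fin n × Fin m × Fin m => swapSet x.1 x.2.1 x.2.2 := by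
  rintro ⟨a, i, t⟩ ⟨b, j, u⟩ h
  dsimp only at h
  have h1 : lower a t ∈ swapSet b j u := h ▸ mem_swapSet.2 (Or.inl rfl)
  have h2 : upper a i ∉ swapSet b j u := by
    rw [← h, mem_swapSet]
    simp [(lower_ne_upper a a i t).symm]
  rw [mem_swapSet] at h1 h2
  simp only [lower_notMem_refSet, and_false, or_false, lower_inj] at h1
  simp only [(lower_ne_upper _ _ _ _).symm, upper_mem_refSet, and_true, false_or, not_not,
    upper_inj, ne_eq] at h2
  simp [h1, h2]

theorem isProper_refSet : IsProper (V := Fin n) (d := 2 * m) m (refSet (Fin n) (2 * m) m) := by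
  intro a
  have : refSet (Fin n) (2 * m) m ∩ block (2 * m) a =
      (Finset.univ : Finset (Fin m)).image (upper a) := by
    ext x
    simp only [Finset.mem_inter, Finset.mem_image, Finset.mem_univ, true_and]
    constructor
    · rintro ⟨h1, h2⟩
      obtain ⟨i, hi⟩ := exists_upper h1
      rw [hi, upper_mem_block] at h2
      exact ⟨i, h2 ▸ hi.symm⟩
    · rintro ⟨i, rfl⟩
      exact ⟨upper_mem_refSet a i, upper_mem_block.2 rfl⟩
  rw [this, Finset.card_image_of_injective _ fun i j h => (upper_inj.1 h).2]
  simp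

theorem isProper_swapSet (a : Fin n) (i t : Fin m) :
    IsProper (V := Fin n) (d := 2 * m) m (swapSet a i t) := by
  intro b
  by_cases h : a = b
  · subst h
    have : swapSet a i t ∩ block (2 * m) a =
        insert (lower a t) ((refSet (Fin n) (2 * m) m ∩ block (2 * m) a).erase (upper a i)) := by
      ext x
      simp only [Finset.mem_inter, mem_swapSet, Finset.mem_insert, Finset.mem_erase]
      constructor
      · tauto
      · rintro (rfl | h)
        · simp [lower_mem_block]
        · tauto
    rw [this, Finset.card_insert_of_notMem (by simp [lower_notMem_refSet]),
      Finset.card_erase_of_mem (by simp [upper_mem_refSet, upper_mem_block]), isProper_refSet]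
    have := i.pos
    omega
  · have : swapSet a i t ∩ block (2 * m) b = refSet (Fin n) (2 * m) m ∩ block (2 * m) b := by
      ext x
      simp only [Finset.mem_inter, mem_swapSet]
      constructor
      · rintro ⟨rfl | h1, h2⟩
        · exact absurd (lower_mem_block.1 h2) h
        · exact ⟨h1.2, h2⟩
      · rintro ⟨h1, h2⟩
        exact ⟨Or.inr ⟨fun e => h (upper_mem_block.1 (e ▸ h2)), h1⟩, h2⟩
    rw [this, isProper_refSet]

theorem eps_self (s : Fin n ×ₗ Fin (2 * m)) : eps (refSet (Fin n) (2 * m) m) s s = 0 := by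
  simp only [eps, min_self, max_self, Finset.card_eq_zero, Finset.filter_eq_empty_iff]
  rintro x - ⟨h1, h2⟩
  exact h1.not_gt h2

/-- All elements outside the reference set precede those inside it at the same vertex, so the
elements strictly between are the `i` reference elements below `upper a i`, whatever `t` is. -/
theorem eps_upper_lower (a : Fin n) (i t : Fin m) :
    eps (refSet (Fin n) (2 * m) m) (upper a i) (lower a t) = i := by
  have hlt : lower a t < upper a i := by
    simp only [lower, upper, Prod.Lex.toLex_lt_toLex, Fin.lt_def]
    right
    exact ⟨trivial, by omega⟩
  rw [eps, min_eq_right hlt.le, max_eq_left hlt.le]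
  have : ((refSet (Fin n) (2 * m) m).filter fun x => lower a t < x ∧ x < upper a i) =
      (Finset.univ.filter fun j : Fin m => j < i).image (upper a) := by
    ext x
    simp only [Finset.mem_filter, Finset.mem_image, Finset.mem_univ, true_and]
    constructor
    · rintro ⟨h1, h2, h3⟩
      obtain ⟨j, hj⟩ := exists_upper h1
      generalize (ofLex x).1 = b at hj
      subst hj
      simp only [lower, upper, Prod.Lex.toLex_lt_toLex, Fin.lt_def] at h2 h3
      have hb : b = a := by ext; omega
      subst hb
      exact ⟨j, by simp only [Fin.lt_def]; omega, rfl⟩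
    · rintro ⟨j, hj, rfl⟩
      refine ⟨upper_mem_refSet a j, ?_, ?_⟩ <;>
      · simp only [lower, upper, Prod.Lex.toLex_lt_toLex, Fin.lt_def] at hj ⊢
        right
        exact ⟨trivial, by omega⟩
  rw [this, Finset.card_image_of_injective _ fun i j h => (upper_inj.1 h).2]
  have h : (Finset.univ.filter fun j : Fin m => j < i) = Finset.Iio i := by ext; simp
  rw [h, Fin.card_Iio]

theorem mem_srcRange {a : Fin n} {i : Fin m} {x : Fin n ×ₗ Fin (2 * m)} :
    x ∈ srcRange m a (upper a i) ↔ x = upper a i ∨ ∃ t, x = lower a t := by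
  simp only [srcRange, Finset.mem_sdiff, Finset.mem_erase, not_and]
  constructor
  · rintro ⟨h1, h2⟩
    by_cases h : x ∈ refSet (Fin n) (2 * m) m
    · exact Or.inl (by_contra fun h' => h2 h' h)
    · obtain ⟨t, ht⟩ := exists_lower h
      rw [ht, lower_mem_block] at h1
      exact Or.inr ⟨t, h1 ▸ ht⟩
  · rintro (rfl | ⟨t, rfl⟩)
    · simp [upper_mem_block]
    · simp [lower_mem_block, lower_notMem_refSet]

theorem mem_tgtRange {b : Fin n} {x : Fin n ×ₗ Fin (2 * m)} :
    x ∈ tgtRange (2 * m) m b ↔ ∃ i, x = upper b i := by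
  simp only [tgtRange, Finset.mem_inter]
  constructor
  · rintro ⟨h1, h2⟩
    obtain ⟨i, hi⟩ := exists_upper h2
    rw [hi, upper_mem_block] at h1
    exact ⟨i, h1 ▸ hi⟩
  · rintro ⟨i, rfl⟩
    simp [upper_mem_block, upper_mem_refSet]

/-- The quiver relation of an arrow with the identity matrix. -/
theorem quiverRel_one (K : Type*) [Field K] (a b : Fin n) (i t : Fin m) :
    quiverRel m a b (1 : Matrix (Fin (2 * m)) (Fin (2 * m)) K) (upper a i) (lower b t) =
      MvPolynomial.X (refSet (Fin n) (2 * m) m) * MvPolynomial.X (swapSet b i t) -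
        MvPolynomial.C ((-1) ^ (i : ℕ)) * MvPolynomial.X (swapSet a i t) *
          MvPolynomial.X (refSet (Fin n) (2 * m) m) := by
  rw [quiverRel]
  congr 1
  -- Since `t'` lies in the upper half, a nonzero matrix entry forces `s'` there too; the only upper
  -- element in the source range is `upper a i` itself.
  · rw [Finset.sum_eq_single (upper a i), Finset.sum_eq_single (upper b i)]
    · rw [eps_self, exchange_self (upper_mem_refSet a i)]
      have h : (1 : Matrix (Fin (2 * m)) (Fin (2 * m)) K) (ofLex (upper a i)).2
        (ofLex (upper b i)).2 = 1 := Matrix.one_apply_eq _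
      rw [h, swapSet, pow_zero, mul_one, map_one, one_mul]
    · intro x hx hne
      obtain ⟨j, rfl⟩ := mem_tgtRange.1 hx
      have : i ≠ j := fun h => hne (h ▸ rfl)
      simp [upper, Matrix.one_apply, Fin.ext_iff, Fin.val_ne_of_ne this]
    · exact fun h => absurd (mem_tgtRange.2 ⟨i, rfl⟩) h
    · intro x hx hne
      obtain h | ⟨u, rfl⟩ := mem_srcRange.1 hx
      · exact absurd h hne
      · refine Finset.sum_eq_zero fun y hy => ?_
        obtain ⟨j, rfl⟩ := mem_tgtRange.1 hy
        have : (u : ℕ) ≠ m + j := by omega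
        simp [upper, lower, Matrix.one_apply, this]
    · exact fun h => absurd (mem_srcRange.2 (Or.inl rfl)) h
  -- Here `t` lies in the lower half, so the surviving `s'` is the lower element at the same
  -- position.
  · rw [Finset.sum_eq_single (lower a t)]
    · rw [eps_upper_lower]
      have h : (1 : Matrix (Fin (2 * m)) (Fin (2 * m)) K) (ofLex (lower a t)).2
        (ofLex (lower b t)).2 = 1 := Matrix.one_apply_eq _
      rw [h, swapSet, mul_one]
    · intro x hx hne
      obtain rfl | ⟨u, rfl⟩ := mem_srcRange.1 hx
      · have : m + (i : ℕ) ≠ t := by omega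
        simp [upper, lower, Matrix.one_apply, this]
      · have : u ≠ t := fun h => hne (h ▸ rfl)
        simp [lower, Matrix.one_apply, Fin.ext_iff, Fin.val_ne_of_ne this]
    · exact fun h => absurd (mem_srcRange.2 (Or.inr ⟨t, rfl⟩)) h

end Exchange


/-! ### Young diagrams of exchange sets -/

section YoungExchange

variable {n m : ℕ}

/-- In a proper index set, the elements below a basis vector are the `m` ones of every preceding
vertex and those below it at its own vertex. -/
theorem card_filter_lt_of_isProper {J : Finset (Fin n ×ₗ Fin (2 * m))}
    (hJ : IsProper (V := Fin n) (d := 2 * m) m J) (b : Fin n) (k : Fin (2 * m)) :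
    (J.filter fun x => x < toLex (b, k)).card =
      b * m + (Finset.univ.filter fun l => l < k ∧ toLex (b, l) ∈ J).card := by
  have h1 : (J.filter fun x => x < toLex (b, k)) =
      ((Finset.Iio b).biUnion fun a => J ∩ block (2 * m) a) ∪
        (Finset.univ.filter fun l => l < k ∧ toLex (b, l) ∈ J).image fun l => toLex (b, l) := by
    ext x
    obtain ⟨⟨a, l⟩, rfl⟩ := toLex.surjective x
    simp only [Finset.mem_filter, Prod.Lex.toLex_lt_toLex, Finset.mem_union, Finset.mem_biUnion,
      Finset.mem_Iio, Finset.mem_inter, block, Finset.mem_univ, true_and, Finset.mem_image,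
      ofLex_toLex, EmbeddingLike.apply_eq_iff_eq, Prod.mk.injEq]
    constructor
    · rintro ⟨h, h' | ⟨rfl, h'⟩⟩
      · exact Or.inl ⟨a, h', h, rfl⟩
      · exact Or.inr ⟨l, ⟨h', h⟩, rfl, rfl⟩
    · rintro (⟨c, h, h', rfl⟩ | ⟨c, ⟨h, h'⟩, rfl, rfl⟩)
      · exact ⟨h', Or.inl h⟩
      · exact ⟨h', Or.inr ⟨rfl, h⟩⟩
  rw [h1, Finset.card_union_of_disjoint, Finset.card_biUnion, Finset.sum_congr rfl fun a _ => hJ a,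
    Finset.card_image_of_injective]
  · simp
  · intro l l' h
    simpa using h
  · intro a _ c _ hac
    simp only [Function.onFun, Finset.disjoint_left]
    intro x hx hx'
    simp only [block, Finset.mem_inter, Finset.mem_filter] at hx hx'
    exact hac (hx.2.2.symm.trans hx'.2.2)
  · simp only [Finset.disjoint_left]
    intro x hx hx'
    simp only [Finset.mem_biUnion, block, Finset.mem_inter, Finset.mem_filter, Finset.mem_Iio,
      Finset.mem_image] at hx hx'
    obtain ⟨c, hc, -, -, rfl⟩ := hx
    obtain ⟨l, -, rfl⟩ := hx'
    exact lt_irrefl _ hc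

/-- Only the multiset of row lengths matters, so the enumeration `e` of the complement need not be
monotone. -/
theorem young_eq_of_enumeration {α : Type*} [Fintype α] {J : Finset (Fin n ×ₗ Fin (2 * m))}
    (e : α → Fin n ×ₗ Fin (2 * m)) (he : Function.Injective e) (hJ : ∀ c, c ∉ J ↔ ∃ x, e x = c)
    (g : α → ℕ) (hg : ∀ x, (J.filter fun i => i < e x).card + 1 = g x) :
    young J = diagramOfParts (Finset.univ.val.map g) := by
  have h : Finset.univ \ J = Finset.univ.map ⟨e, he⟩ := by
    ext c
    simp [hJ]
  rw [young, h, Finset.map_val, Multiset.map_map]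
  congr 2
  funext x
  exact hg x

theorem young_refSet :
    young (refSet (Fin n) (2 * m) m) = diagramOfParts (Finset.univ.val.map (baseRow n m)) := by
  refine young_eq_of_enumeration (fun x => lower x.1 x.2) ?_ ?_ _ ?_
  · rintro ⟨a, t⟩ ⟨b, u⟩ h
    rw [Prod.mk.injEq]
    exact lower_inj.1 h
  · intro c
    constructor
    · intro h
      obtain ⟨t, ht⟩ := exists_lower h
      exact ⟨(_, t), ht.symm⟩
    · rintro ⟨x, rfl⟩
      exact lower_notMem_refSet _ _
  · rintro ⟨b, r⟩
    rw [lower, card_filter_lt_of_isProper isProper_refSet, baseRow, add_left_inj,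
      Nat.add_eq_left, Finset.card_eq_zero, Finset.filter_eq_empty_iff]
    rintro l - ⟨h1, h2⟩
    rw [mem_refSet] at h2
    simp only [ofLex_toLex, Fin.lt_def] at h1 h2
    omega

/-- The basis vectors outside the set `swapSet a i t`, in increasing order at every vertex. -/
def complEnum (a : Fin n) (i t : Fin m) (x : Fin n × Fin m) : Fin n ×ₗ Fin (2 * m) :=
  toLex (x.1, ⟨if x.1 = a then
    if (x.2 : ℕ) + 1 = m then m + i else if (x.2 : ℕ) < t then x.2 else x.2 + 1 else x.2, by
      split_ifs <;> omega⟩)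

theorem toLex_mem_swapSet {a b : Fin n} {i t : Fin m} {k : Fin (2 * m)} :
    toLex (b, k) ∈ swapSet a i t ↔
      (b = a ∧ (k : ℕ) = t) ∨ (m ≤ (k : ℕ) ∧ (b = a → (k : ℕ) ≠ m + i)) := by
  rw [mem_swapSet, mem_refSet]
  simp only [lower, upper, EmbeddingLike.apply_eq_iff_eq, Prod.mk.injEq, Fin.ext_iff, ne_eq,
    ofLex_toLex]
  tauto

theorem complEnum_injective (a : Fin n) (i t : Fin m) : Function.Injective (complEnum a i t) := by
  rintro ⟨b, r⟩ ⟨c, r'⟩ h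
  simp only [complEnum, EmbeddingLike.apply_eq_iff_eq, Prod.mk.injEq, Fin.mk.injEq] at h
  obtain ⟨rfl, h⟩ := h
  have : (r : ℕ) = r' := by
    split_ifs at h <;> omega
  rw [Fin.ext this]

theorem notMem_swapSet_iff (a : Fin n) (i t : Fin m) (c : Fin n ×ₗ Fin (2 * m)) :
    c ∉ swapSet a i t ↔ ∃ x, complEnum a i t x = c := by
  obtain ⟨⟨b, k⟩, rfl⟩ := toLex.surjective c
  rw [toLex_mem_swapSet]
  have ht := t.isLt
  have hi := i.isLt
  simp only [complEnum, EmbeddingLike.apply_eq_iff_eq, Prod.mk.injEq, Prod.exists, Fin.ext_iff]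
  constructor
  · intro h
    by_cases hb : (b : ℕ) = a
    · simp only [hb, true_and, true_implies, not_or, not_and, not_not] at h
      by_cases hk : m ≤ (k : ℕ)
      · refine ⟨b, ⟨m - 1, by omega⟩, rfl, ?_⟩
        rw [if_pos hb, if_pos (by simp only; omega), h.2 hk]
      · by_cases hkt : (k : ℕ) < t
        · refine ⟨b, ⟨k, by omega⟩, rfl, ?_⟩
          rw [if_pos hb, if_neg (by simp only; omega), if_pos hkt]
        -- Past the removed position `t` the enumeration is shifted by one.
        · refine ⟨b, ⟨k - 1, by omega⟩, rfl, ?_⟩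
          rw [if_pos hb, if_neg (by simp only; omega), if_neg (by simp only; omega)]
          simp only
          omega
    · simp only [hb, false_and, false_implies, and_true, false_or, not_le] at h
      exact ⟨b, ⟨k, h⟩, rfl, by rw [if_neg hb]⟩
  · rintro ⟨b', r, hb, hk⟩
    rw [hb] at hk
    split_ifs at hk <;> omega

theorem card_below_swapSet_eq_zero {a b : Fin n} {i t : Fin m} {k : Fin (2 * m)}
    (hk : (k : ℕ) < m) (h : b = a → k ≤ (t : ℕ)) :
    (Finset.univ.filter fun l => l < k ∧ toLex (b, l) ∈ swapSet a i t).card = 0 := by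
  rw [Finset.card_eq_zero, Finset.filter_eq_empty_iff]
  rintro l - ⟨h1, h2⟩
  rw [toLex_mem_swapSet] at h2
  rw [Fin.lt_def] at h1
  rcases h2 with ⟨h2, h3⟩ | ⟨h2, -⟩
  · have := h h2
    omega
  · omega

theorem card_below_swapSet_eq_one {a : Fin n} {i t : Fin m} {k : Fin (2 * m)}
    (hk : (k : ℕ) < m) (h : (t : ℕ) < k) :
    (Finset.univ.filter fun l => l < k ∧ toLex (a, l) ∈ swapSet a i t).card = 1 := by
  rw [Finset.card_eq_one]
  refine ⟨⟨t, by omega⟩, ?_⟩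
  ext l
  simp only [Finset.mem_filter, Finset.mem_univ, true_and, toLex_mem_swapSet,
    Finset.mem_singleton, Fin.ext_iff, Fin.lt_def]
  omega

theorem card_below_swapSet_upper {a : Fin n} {i t : Fin m} {k : Fin (2 * m)}
    (hk : (k : ℕ) = m + i) :
    (Finset.univ.filter fun l => l < k ∧ toLex (a, l) ∈ swapSet a i t).card = i + 1 := by
  have h : (Finset.univ.filter fun l => l < k ∧ toLex (a, l) ∈ swapSet a i t) =
      insert ⟨t, by omega⟩ (Finset.Ico ⟨m, by have := i.isLt; omega⟩ k) := by
    ext l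
    simp only [Finset.mem_filter, Finset.mem_univ, true_and, toLex_mem_swapSet,
      Finset.mem_insert, Finset.mem_Ico, Fin.ext_iff, Fin.lt_def, Fin.le_def]
    omega
  rw [h, Finset.card_insert_of_notMem, Fin.card_Ico]
  · simp only [hk]
    omega
  · simp only [Finset.mem_Ico, Fin.le_def]
    omega

/-- At the vertex `a`, missing vectors below position `t` gain no box over the base row, those
between `t` and the upper half gain one from `lower a t`, and `upper a i` gains `i + 1`: the `i`
reference elements below it and `lower a t`. This leaves `t` zeros, hence `u = m - t`. Other groups
are unaffected, since an exchange preserves the number of elements per vertex. -/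
theorem young_swapSet (a : Fin n) (i t : Fin m) :
    young (swapSet a i t) = ladderDiagram n m (i + 1, m - t) a := by
  refine young_eq_of_enumeration _ (complEnum_injective a i t) (notMem_swapSet_iff a i t) _ ?_
  rintro ⟨b, r⟩
  rw [complEnum, card_filter_lt_of_isProper (isProper_swapSet a i t)]
  dsimp only
  rw [add_assoc, add_assoc, add_right_inj, add_comm, add_right_inj]
  by_cases hb : b = a
  · subst hb
    simp only [if_true]
    unfold ladderBlock
    by_cases h1 : (r : ℕ) + 1 = m
    · rw [card_below_swapSet_upper (by simp [h1]), if_pos h1]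
    · by_cases h2 : (r : ℕ) < t
      · rw [card_below_swapSet_eq_zero, if_neg h1, if_neg (by omega)] <;>
        · simp only [h1, h2, if_true, if_false]
          omega
      · rw [card_below_swapSet_eq_one, if_neg h1, if_pos (by omega)] <;>
        · simp only [h1, h2, if_false]
          omega
  · simp only [hb, if_false]
    exact card_below_swapSet_eq_zero (by simp) (fun h => absurd h hb)

end YoungExchange


/-! ### The general solution for the universal quiver -/

section Solution

variable (K : Type*) [Field K] {n m : ℕ}

/-- The coordinate of the general solution at the index set `swapSet a i t`. -/
noncomputable abbrev swapCoord (a : Fin n) (i t : Fin m) :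
    SolRing (univQuiver n) m (idRep K n (2 * m)) :=
  coord (univQuiver n) m (idRep K n (2 * m)) (swapSet a i t)

theorem mk_eq_zero_of_isRelation {f : MvPolynomial (Finset (Fin n ×ₗ Fin (2 * m))) K}
    (hf : IsRelation (univQuiver n) m (idRep K n (2 * m)) f) :
    Ideal.Quotient.mk (Ideal.span {f | IsRelation (univQuiver n) m (idRep K n (2 * m)) f}) f = 0 :=
  Ideal.Quotient.eq_zero_iff_mem.2 (Ideal.subset_span hf)

theorem coord_refSet :
    coord (univQuiver n) m (idRep K n (2 * m)) (refSet (Fin n) (2 * m) m) = 1 := by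
  have h := mk_eq_zero_of_isRelation K
    (IsRelation.normalization (Q := univQuiver n) (e := m) (M := idRep K n (2 * m)))
  rwa [map_sub, map_one, sub_eq_zero] at h

theorem map_eq_of_exchange_relation {σ K R : Type*} [Field K] [CommRing R]
    (φ : MvPolynomial σ K →+* R) {r x y : σ} {i : ℕ} (hr : φ (MvPolynomial.X r) = 1)
    (h : φ (MvPolynomial.X r * MvPolynomial.X y -
      MvPolynomial.C ((-1) ^ i) * MvPolynomial.X x * MvPolynomial.X r) = 0) :
    φ (MvPolynomial.X y) = (-1) ^ i * φ (MvPolynomial.X x) := by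
  simp only [map_sub, map_mul, map_pow, map_neg, map_one] at h
  rwa [hr, one_mul, mul_one, sub_eq_zero] at h

theorem swapCoord_eq {a b : Fin n} (hab : a ≠ b) (i t : Fin m) :
    swapCoord K b i t = (-1) ^ (i : ℕ) * swapCoord K a i t := by
  have h := mk_eq_zero_of_isRelation K
    (IsRelation.quiver (Q := univQuiver n) (e := m) (M := idRep K n (2 * m)) a b ⟨hab⟩
      (upper a i) (lower b t) (by simp [upper_mem_block, upper_mem_refSet])
      (by simp [lower_mem_block, lower_notMem_refSet]))
  rw [idRep, quiverRel_one] at h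
  exact map_eq_of_exchange_relation _ (coord_refSet K) h

theorem eq_of_eq_neg_one_pow_mul {R : Type*} [CommRing R] {x y : R} {i : ℕ} (hi : Even i)
    (h : y = (-1) ^ i * x) : y = x := by
  rwa [hi.neg_one_pow, one_mul] at h

/-- The values `x`, `y`, `z` sit at the corners of a triangle of arrows: two sign changes along one
path conflict with a single one along the other. -/
theorem two_mul_eq_zero_of_odd {R : Type*} [CommRing R] {x y z : R} {i : ℕ} (hi : Odd i)
    (h1 : y = (-1) ^ i * x) (h2 : z = (-1) ^ i * x) (h3 : z = (-1) ^ i * y) : 2 * x = 0 := by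
  rw [hi.neg_one_pow] at h1 h2 h3
  linear_combination h1 + h2 - h3

theorem swapCoord_of_even {i : Fin m} (hi : Even (i : ℕ)) (t : Fin m) (a b : Fin n) :
    swapCoord K a i t = swapCoord K b i t := by
  by_cases h : b = a
  · rw [h]
  · exact eq_of_eq_neg_one_pow_mul hi (swapCoord_eq K h i t)

variable {K} in
theorem swapCoord_of_odd (h2 : (2 : K) ≠ 0) (hn : 3 ≤ n) {i : Fin m} (hi : Odd (i : ℕ))
    (t : Fin m) (a : Fin n) : swapCoord K a i t = 0 := by
  obtain ⟨b, hb⟩ := Finset.exists_mem_notMem_of_card_lt_card (s := {a})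
    (t := (Finset.univ : Finset (Fin n))) (by simp; omega)
  obtain ⟨c, hc⟩ := Finset.exists_mem_notMem_of_card_lt_card (s := {a, b})
    (t := (Finset.univ : Finset (Fin n)))
    (lt_of_le_of_lt Finset.card_le_two (by simp; omega))
  simp only [Finset.mem_univ, Finset.mem_singleton, Finset.mem_insert, not_or, true_and] at hb hc
  have e := two_mul_eq_zero_of_odd hi (swapCoord_eq K (Ne.symm hb) i t)
    (swapCoord_eq K (Ne.symm hc.1) i t) (swapCoord_eq K (Ne.symm hc.2) i t)
  -- The solution ring is a `K`-algebra, so 2 is invertible in it and can be cancelled.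
  have hu : IsUnit (algebraMap K (SolRing (univQuiver n) m (idRep K n (2 * m))) 2) :=
    (IsUnit.mk0 _ h2).map _
  rw [map_ofNat] at hu
  exact hu.mul_right_eq_zero.1 e

/-! ### A solution with independent values -/

open Classical in
/-- The values of the coordinates in the solution with independent values `X (i, t)`. -/
noncomputable def genericValue (J : Finset (Fin n ×ₗ Fin (2 * m))) :
    MvPolynomial (Fin m × Fin m) K :=
  if J = refSet (Fin n) (2 * m) m then 1 else
    Function.extend (fun x : Fin n × Fin m × Fin m => swapSet x.1 x.2.1 x.2.2)
      (fun x => if Even (x.2.1 : ℕ) then MvPolynomial.X x.2 else 0) 0 J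

theorem genericValue_refSet : genericValue K (refSet (Fin n) (2 * m) m) = 1 := if_pos rfl

theorem genericValue_swapSet (a : Fin n) (i t : Fin m) :
    genericValue K (swapSet a i t) = if Even (i : ℕ) then MvPolynomial.X (i, t) else 0 := by
  rw [genericValue, if_neg (swapSet_ne_refSet a i t)]
  exact swapSet_injective.extend_apply _ _ (a, i, t)

theorem genericValue_of_not_isProper {J : Finset (Fin n ×ₗ Fin (2 * m))}
    (hJ : ¬ IsProper (V := Fin n) (d := 2 * m) m J) : genericValue K J = 0 := by
  rw [genericValue, if_neg (by rintro rfl; exact hJ isProper_refSet), Function.extend_apply']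
  · rfl
  · rintro ⟨x, rfl⟩
    exact hJ (isProper_swapSet _ _ _)

/-- The sign is visible only for odd `i`, where both values are zero. -/
theorem sub_eq_zero_of_odd_vanishing {R : Type*} [CommRing R] (i : ℕ) (x : R) :
    1 * (if Even i then x else 0) - (-1) ^ i * (if Even i then x else 0) * 1 = 0 := by
  split_ifs with h
  · rw [h.neg_one_pow]; ring
  · ring

theorem aeval_genericValue_of_isRelation {f : MvPolynomial (Finset (Fin n ×ₗ Fin (2 * m))) K}
    (hf : IsRelation (univQuiver n) m (idRep K n (2 * m)) f) :
    MvPolynomial.aeval (genericValue K) f = 0 := by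
  cases hf with
  | quiver a b v s t hs ht =>
    rw [Finset.mem_inter] at hs
    rw [Finset.mem_sdiff] at ht
    obtain ⟨i, hi⟩ := exists_upper hs.2
    obtain ⟨u, hu⟩ := exists_lower ht.2
    rw [hi, upper_mem_block] at hs
    rw [hu, lower_mem_block] at ht
    rw [hs.1] at hi
    rw [ht.1] at hu
    subst hi hu
    rw [idRep, quiverRel_one]
    simp only [map_sub, map_mul, map_pow, map_neg, map_one, MvPolynomial.aeval_X,
      genericValue_refSet, genericValue_swapSet]
    exact sub_eq_zero_of_odd_vanishing _ _
  | nonproper J hJ => rw [MvPolynomial.aeval_X, genericValue_of_not_isProper K hJ]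
  | normalization => rw [map_sub, map_one, MvPolynomial.aeval_X, genericValue_refSet, sub_self]

variable (n m) in
/-- The evaluation of the general solution at `genericValue`. -/
noncomputable def genericEval :
    SolRing (univQuiver n) m (idRep K n (2 * m)) →ₐ[K] MvPolynomial (Fin m × Fin m) K :=
  Ideal.Quotient.liftₐ _ (MvPolynomial.aeval (genericValue K)) fun f hf => by
    have : Ideal.span {f | IsRelation (univQuiver n) m (idRep K n (2 * m)) f} ≤
        RingHom.ker (MvPolynomial.aeval (genericValue K) :
          MvPolynomial (Finset (Fin n ×ₗ Fin (2 * m))) K →ₐ[K] _) :=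
      Ideal.span_le.2 fun g hg => aeval_genericValue_of_isRelation K hg
    exact this hf

theorem genericEval_coord (J : Finset (Fin n ×ₗ Fin (2 * m))) :
    genericEval K n m (coord (univQuiver n) m (idRep K n (2 * m)) J) = genericValue K J :=
  (Ideal.Quotient.liftₐ_apply _ _ _ _).trans (MvPolynomial.aeval_X _ _)

theorem genericEval_swapCoord (a : Fin n) {i : Fin m} (hi : Even (i : ℕ)) (t : Fin m) :
    genericEval K n m (swapCoord K a i t) = MvPolynomial.X (i, t) := by
  rw [genericEval_coord, genericValue_swapSet, if_pos hi]

theorem swapCoord_ne_zero (a : Fin n) {i : Fin m} (hi : Even (i : ℕ)) (t : Fin m) :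
    swapCoord K a i t ≠ 0 := fun h => by
  have := genericEval_swapCoord K a hi t
  rw [h, map_zero] at this
  exact MvPolynomial.X_ne_zero _ this.symm

variable {K}

theorem swapSet_mem_fset (hn : 2 ≤ n) (a : Fin n) {i : Fin m} (hi : Even (i : ℕ)) (t : Fin m) :
    swapSet a i t ∈ fset (univQuiver n) m (idRep K n (2 * m)) := by
  have : Nontrivial (Fin n) := Fin.nontrivial_iff_two_le.2 hn
  obtain ⟨b, hb⟩ := exists_ne a
  classical
  exact Finset.mem_filter.2 ⟨Finset.mem_univ _, Occurs.src (Q := univQuiver n) a b (PLift.up hb.symm) (upper a i) (lower b t) (lower a t)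
    (by simp [upper_mem_block, upper_mem_refSet]) (by simp [lower_mem_block, lower_notMem_refSet])
    (mem_srcRange.2 (Or.inr ⟨t, rfl⟩)), swapCoord_ne_zero K a hi t⟩

theorem eq_swapSet_of_occurs {J : Finset (Fin n ×ₗ Fin (2 * m))}
    (hJ : Occurs (univQuiver n) m J) (hI : J ≠ refSet (Fin n) (2 * m) m) :
    ∃ (a : Fin n) (i t : Fin m), J = swapSet a i t := by
  cases hJ with
  | src a b v s t s' hs ht hs' =>
    rw [Finset.mem_inter] at hs
    obtain ⟨i, hi⟩ := exists_upper hs.2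
    rw [hi, upper_mem_block] at hs
    rw [hs.1] at hi
    subst hi
    obtain rfl | ⟨u, rfl⟩ := mem_srcRange.1 hs'
    · exact absurd (exchange_self hs.2) hI
    · exact ⟨a, i, u, rfl⟩
  | tgt a b v s t t' hs ht ht' =>
    rw [Finset.mem_sdiff] at ht
    obtain ⟨u, hu⟩ := exists_lower ht.2
    rw [hu, lower_mem_block] at ht
    rw [ht.1] at hu
    obtain ⟨i, rfl⟩ := mem_tgtRange.1 ht'
    exact ⟨b, i, u, by rw [hu]; rfl⟩

theorem exists_of_mem_fset (h2 : (2 : K) ≠ 0) (hnm : 3 ≤ n ∨ (n = 2 ∧ m = 1))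
    {J : Finset (Fin n ×ₗ Fin (2 * m))} (hJ : J ∈ fset (univQuiver n) m (idRep K n (2 * m)))
    (hI : J ≠ refSet (Fin n) (2 * m) m) :
    ∃ (a : Fin n) (i t : Fin m), Even (i : ℕ) ∧ J = swapSet a i t := by
  classical
  replace hJ := Finset.mem_filter.1 hJ
  obtain ⟨a, i, t, rfl⟩ := eq_swapSet_of_occurs hJ.2.1 hI
  refine ⟨a, i, t, ?_, rfl⟩
  by_contra h
  rw [Nat.not_even_iff_odd] at h
  rcases hnm with hn | ⟨-, rfl⟩
  · exact hJ.2.2 (swapCoord_of_odd h2 hn h t a)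
  -- For `m = 1` the only index is 0, which is not odd.
  · rw [Subsingleton.elim i 0] at h
    simp at h

/-! ### The cells of the ladder -/

/-- The position in the reference set that belongs to a cell of the ladder. -/
def cellUpper (i : ladder m) : Fin m := ⟨i.1.1 - 1, by have := mem_ladder.1 i.2; omega⟩

/-- The position outside the reference set that belongs to a cell of the ladder. -/
def cellLower (i : ladder m) : Fin m := ⟨m - i.1.2, by have := mem_ladder.1 i.2; omega⟩

theorem even_cellUpper (i : ladder m) : Even (cellUpper i : ℕ) := by
  have := mem_ladder.1 i.2
  exact Nat.Odd.sub_odd this.2 odd_one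

theorem cell_injective : Function.Injective fun i : ladder m => (cellUpper i, cellLower i) := by
  rintro i i' h
  have h1 := mem_ladder.1 i.2
  have h2 := mem_ladder.1 i'.2
  simp only [cellUpper, cellLower, Prod.mk.injEq, Fin.mk.injEq] at h
  ext <;> omega

theorem exists_cell {i : Fin m} (hi : Even (i : ℕ)) (t : Fin m) :
    ∃ c : ladder m, cellUpper c = i ∧ cellLower c = t := by
  refine ⟨⟨(i + 1, m - t), mem_ladder.2 ⟨by dsimp only; omega, hi.add_one⟩⟩, ?_, ?_⟩ <;>
  · ext
    simp [cellUpper, cellLower]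
    try omega

theorem young_swapSet_cell (a : Fin n) (i : ladder m) :
    young (swapSet a (cellUpper i) (cellLower i)) = ladderDiagram n m i a := by
  have h := mem_ladder.1 i.2
  rw [young_swapSet]
  congr 1
  ext <;> simp [cellUpper, cellLower] <;> omega

theorem exists_cell_of_mem_fset (h2 : (2 : K) ≠ 0) (hnm : 3 ≤ n ∨ (n = 2 ∧ m = 1))
    {J : Finset (Fin n ×ₗ Fin (2 * m))} (hJ : J ∈ fset (univQuiver n) m (idRep K n (2 * m)))
    (hI : J ≠ refSet (Fin n) (2 * m) m) :
    ∃ (i : ladder m) (a : Fin n), J = swapSet a (cellUpper i) (cellLower i) := by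
  obtain ⟨a, i, t, hi, rfl⟩ := exists_of_mem_fset h2 hnm hJ hI
  obtain ⟨c, rfl, rfl⟩ := exists_cell hi t
  exact ⟨c, a, rfl⟩

theorem ladderDiagram_inj {i i' : ladder m} {j j' : Fin n}
    (h : ladderDiagram n m i j = ladderDiagram n m i' j') : i = i' ∧ j = j' := by
  have := @ladderDiagram_injOn n m (i.1, j) i.2 (i'.1, j') i'.2 h
  rw [Prod.mk.injEq] at this
  exact ⟨Subtype.ext this.1, this.2⟩

/-! ### The bijection, the independence and the sum -/

theorem bijOn_young (h2 : (2 : K) ≠ 0) (hnm : 3 ≤ n ∨ (n = 2 ∧ m = 1)) :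
    Set.BijOn (young (V := Fin n) (d := 2 * m))
      {J | J ∈ fset (univQuiver n) m (idRep K n (2 * m)) ∧ J ≠ refSet (Fin n) (2 * m) m}
      {μ | ∃ i ∈ ladder m, ∃ j : Fin n, μ = ladderDiagram n m i j} := by
  refine ⟨?_, ?_, ?_⟩
  · rintro J ⟨hJ, hI⟩
    obtain ⟨i, a, rfl⟩ := exists_cell_of_mem_fset h2 hnm hJ hI
    exact ⟨i, i.2, a, young_swapSet_cell a i⟩
  · rintro J ⟨hJ, hI⟩ J' ⟨hJ', hI'⟩ h
    obtain ⟨i, a, rfl⟩ := exists_cell_of_mem_fset h2 hnm hJ hI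
    obtain ⟨i', a', rfl⟩ := exists_cell_of_mem_fset h2 hnm hJ' hI'
    rw [young_swapSet_cell, young_swapSet_cell] at h
    obtain ⟨rfl, rfl⟩ := ladderDiagram_inj h
    rfl
  · rintro μ ⟨i, hi, j, rfl⟩
    exact ⟨_, ⟨swapSet_mem_fset (by omega) j (even_cellUpper ⟨i, hi⟩) (cellLower ⟨i, hi⟩),
      swapSet_ne_refSet _ _ _⟩, young_swapSet_cell j ⟨i, hi⟩⟩

/-- Independence can be checked after applying `genericEval`, which sends these coordinates to
distinct variables. -/
theorem algebraicIndependent_swapCoord (a : Fin n) :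
    AlgebraicIndependent K fun i : ladder m => swapCoord K a (cellUpper i) (cellLower i) := by
  apply AlgebraicIndependent.of_comp (genericEval K n m)
  have h := (MvPolynomial.algebraicIndependent_X (Fin m × Fin m) K).comp _ cell_injective
  convert h using 1
  funext i
  exact genericEval_swapCoord K a (even_cellUpper i) _

theorem pMax_eq_sum (h2 : (2 : K) ≠ 0) (hnm : 3 ≤ n ∨ (n = 2 ∧ m = 1)) (a : Fin n) :
    pMax (univQuiver n) m (idRep K n (2 * m)) =
      ∑ i : ladder m, ∑ j : Fin n,
        schur (SolRing (univQuiver n) m (idRep K n (2 * m))) (ladderDiagram n m i j) *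
          MvPolynomial.C (swapCoord K a (cellUpper i) (cellLower i)) := by
  rw [pMax, ← Fintype.sum_prod_type']
  symm
  refine Finset.sum_bij (fun x _ => swapSet x.2 (cellUpper x.1) (cellLower x.1)) ?_ ?_ ?_ ?_
  · rintro x -
    exact Finset.mem_erase.2 ⟨swapSet_ne_refSet _ _ _,
      swapSet_mem_fset (by omega) _ (even_cellUpper x.1) _⟩
  · rintro ⟨i, j⟩ - ⟨i', j'⟩ - h
    have := congrArg young h
    rw [young_swapSet_cell, young_swapSet_cell] at this
    obtain ⟨rfl, rfl⟩ := ladderDiagram_inj this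
    rfl
  · intro J hJ
    rw [Finset.mem_erase] at hJ
    obtain ⟨i, b, rfl⟩ := exists_cell_of_mem_fset h2 hnm hJ.2 hJ.1
    exact ⟨(i, b), Finset.mem_univ _, rfl⟩
  · rintro x -
    rw [young_swapSet_cell, swapCoord_of_even K (even_cellUpper x.1) _ a x.2]
    exact mul_comm _ _

end Solution

end QuiverPlucker
open QuiverPlucker
theorem lemma1 (K : Type*) [Field K] (h2 : (2 : K) ≠ 0) (n m : ℕ)
    (hnm : 3 ≤ n ∨ (n = 2 ∧ m = 1)) :
    (ladder m).card = m * ⌈(m : ℚ) / 2⌉₊ ∧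
    Set.InjOn (fun ij : (ℕ × ℕ) × Fin n => ladderDiagram n m ij.1 ij.2)
      {ij | ij.1 ∈ ladder m} ∧
    Set.BijOn (young (V := Fin n) (d := 2 * m))
      {J | J ∈ fset (univQuiver n) m (idRep K n (2 * m)) ∧ J ≠ refSet (Fin n) (2 * m) m}
      {μ | ∃ i ∈ ladder m, ∃ j : Fin n, μ = ladderDiagram n m i j} ∧
    ∃ Δ : ladder m → SolRing (univQuiver n) m (idRep K n (2 * m)),
      AlgebraicIndependent K Δ ∧
      (∀ (i : ladder m) (j : Fin n), ∀ J ∈ fset (univQuiver n) m (idRep K n (2 * m)),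
        young J = ladderDiagram n m i j →
          coord (univQuiver n) m (idRep K n (2 * m)) J = Δ i) ∧
      pMax (univQuiver n) m (idRep K n (2 * m)) =
        ∑ i : ladder m, ∑ j : Fin n,
          schur (SolRing (univQuiver n) m (idRep K n (2 * m))) (ladderDiagram n m i j) *
            MvPolynomial.C (Δ i) := by
  have hn : 0 < n := by omega
  refine ⟨card_ladder m, ladderDiagram_injOn n m, bijOn_young h2 hnm,
    fun i => swapCoord K ⟨0, hn⟩ (cellUpper i) (cellLower i),
    algebraicIndependent_swapCoord _, ?_, pMax_eq_sum h2 hnm _⟩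
  intro i j J hJ hy
  -- `fset` may contain `I`, whose coordinate is 1; it is ruled out because the base diagram is not
  -- a ladder diagram.
  have hI : J ≠ refSet (Fin n) (2 * m) m := by
    rintro rfl
    exact ladderDiagram_ne_base i.2 j (hy.symm.trans young_refSet)
  obtain ⟨i', a, rfl⟩ := exists_cell_of_mem_fset h2 hnm hJ hI
  rw [young_swapSet_cell] at hy
  obtain ⟨rfl, rfl⟩ := ladderDiagram_inj hy
  exact swapCoord_of_even K (even_cellUpper i') _ _ _
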